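/- Let $p>2$ be even and, for every $n\ge 1$, let $\mathcal S_n$ be a nonempty subset of the unit sphere of $\mathbb R^n$. Let $A=(A_{i_1,\dots,i_p})_{1\le i_1,\dots,i_p\le n}$ be an array of independent standard normal variables and let $g$ be a standard normal vector in $\mathbb R^n$. The ground state energy (GSE) of the single-partite $p$-spin model with spin sets $\mathcal S=(\mathcal S_n)_n$ is $$\xi^0(p;\mathcal S)=\lim_{n\to\infty}\frac1{\sqrt n}\,\mathbb E_A\max_{x\in\mathcal S_n}\sum_{i_1,\dots,i_p=1}^n A_{i_1,\dots,i_p}\prod_{j=1}^p x_{i_j},$$ and the GSE of the multipartite $p$-spin model whose $j$-th spin vector $x^{(j)}$ ranges over $\mathcal S^{(j)}_n$, $1\le j\le p$, is $$\xi(p;\bar{\mathcal S})=\lim_{n\to\infty}\frac1{\sqrt n}\,\mathbb E_A\max_{x^{(1)}\in\mathcal S^{(1)}_n,\dots,x^{(p)}\in\mathcal S^{(p)}_n}\ \sum_{i_1,\dots,i_p=1}^n A_{i_1,\dots,i_p}\prod_{j=1}^p x^{(j)}_{i_j}$$ (a maximum that is not attained is read as a supremum). For $c>0$ put $$U(c)=\limsup_{n\to\infty}\left(-\frac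 c2(p-1)+\frac1{cn}\log\mathbb E_g\exp\Big(c\sqrt n\,\sqrt p\,\max_{x\in\mathcal S_n}g^Tx\Big)\right).$$ Assume that $\mathcal S^{(j)}_n=\mathcal S_n$ for all $j$ and $n$, that the limit $\xi^0(p;\mathcal S)$ exists, and that it is achieved on the second partial level of lifting, that is, $$\xi^0(p;\mathcal S)=\inf_{c>0}U(c).$$ Then the limit $\xi(p;\bar{\mathcal S})$ exists and $$\xi(p;\bar{\mathcal S})=\sqrt p\;\xi^0(p;\mathcal S).$$ -/

import Mathlib

open MeasureTheory ProbabilityTheory Filter Topology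

namespace PSpin

/-- The law of a family of independent standard normal variables indexed by `ι`. -/
noncomputable def stdNormalLaw (ι : Type) [Fintype ι] : Measure (ι → ℝ) :=
  Measure.pi fun _ => gaussianReal 0 1

/-- Multipartite `p`-spin Hamiltonian
`∑_{i₁,…,i_p} A_{i₁,…,i_p} ∏_j x^{(j)}_{i_j}`. -/
noncomputable def multiHamiltonian {p n : ℕ} (A : (Fin p → Fin n) → ℝ)
    (x : Fin p → EuclideanSpace ℝ (Fin n)) : ℝ :=
  ∑ i : Fin p → Fin n, A i * ∏ j : Fin p, x j (i j)

/-- Single-partite `p`-spin Hamiltonian `∑_{i₁,…,i_p} A_{i₁,…,i_p} ∏_j x_{i_j}`. -/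
noncomputable def singleHamiltonian {p n : ℕ} (A : (Fin p → Fin n) → ℝ)
    (x : EuclideanSpace ℝ (Fin n)) : ℝ :=
  ∑ i : Fin p → Fin n, A i * ∏ j : Fin p, x (i j)

/-- `n^{-1/2} E_A max_{x^{(j)} ∈ S^{(j)}}` of the multipartite Hamiltonian (the supremum is the
maximum whenever the latter exists; it is finite for sets of unit vectors). -/
noncomputable def multiEnergy (p n : ℕ) (S : Fin p → Set (EuclideanSpace ℝ (Fin n))) : ℝ :=
  1 / √(n : ℝ) * ∫ A, sSup (multiHamiltonian A '' {x | ∀ j, x j ∈ S j})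
    ∂(stdNormalLaw (Fin p → Fin n))

/-- `n^{-1/2} E_A max_{x ∈ S}` of the single-partite Hamiltonian. -/
noncomputable def singleEnergy (p n : ℕ) (S : Set (EuclideanSpace ℝ (Fin n))) : ℝ :=
  1 / √(n : ℝ) * ∫ A, sSup (singleHamiltonian A '' S) ∂(stdNormalLaw (Fin p → Fin n))

/-- `G` is the ground state energy of the multipartite model with spin sets
`S^{(j)} = (S j n)_n`: the thermodynamic limit exists and equals `G`. -/
def IsMultiGSE (p : ℕ) (S : Fin p → (n : ℕ) → Set (EuclideanSpace ℝ (Fin n))) (G : ℝ) : Prop :=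
  Tendsto (fun n : ℕ => multiEnergy p n fun j => S j n) atTop (𝓝 G)

/-- `G` is the ground state energy of the single-partite model with spin sets `(S n)_n`. -/
def IsSingleGSE (p : ℕ) (S : (n : ℕ) → Set (EuclideanSpace ℝ (Fin n))) (G : ℝ) : Prop :=
  Tendsto (fun n : ℕ => singleEnergy p n (S n)) atTop (𝓝 G)

/-- The lifted upper bound on the single-partite energy with parameter `c₃ > 0`:
`n^{-1/2} (-(c₃/2)(p-1) + c₃⁻¹ log E_g exp (c₃ √p max_{x ∈ S} gᵀx))`. -/
noncomputable def liftedBound (p n : ℕ) (S : Set (EuclideanSpace ℝ (Fin n))) (c₃ : ℝ) : ℝ :=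
  1 / √(n : ℝ) * (-(c₃ / 2) * ((p : ℝ) - 1) +
    1 / c₃ * Real.log (∫ g, Real.exp (c₃ * √(p : ℝ) *
      sSup ((fun x : EuclideanSpace ℝ (Fin n) => ∑ i, g i * x i) '' S)) ∂(stdNormalLaw (Fin n))))

/-- The thermodynamic limit of the lifted upper bound under the scaling `c₃ = c √n`.
The upper limit is the limit whenever the latter exists. For nonempty sets of unit vectors and
`c > 0` the sequence is bounded, since `xᵀg ≤ max ≤ ‖g‖`, so it is never a default value. -/
noncomputable def limitLiftedBound (p : ℕ) (S : (n : ℕ) → Set (EuclideanSpace ℝ (Fin n)))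
    (c : ℝ) : ℝ :=
  limsup (fun n : ℕ => liftedBound p n (S n) (c * √(n : ℝ))) atTop

/-- `G` is the value of the second partial level of lifting: the infimum over `c > 0` of the
limiting lifted upper bound. -/
def IsSecondPartialLevel (p : ℕ) (S : (n : ℕ) → Set (EuclideanSpace ℝ (Fin n))) (G : ℝ) : Prop :=
  IsGLB (limitLiftedBound p S '' Set.Ioi 0) G

end PSpin

namespace PSpin

/-! Both bounds come from Slepian's lemma: of two centred Gaussian processes with equal variances,
the less correlated one has the stochastically larger supremum. Write `c_j` for the inner product of
`x_j` and `y_j`; the multipartite field has covariance `∏ c_j`.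

Lower bound (`sqrt_mul_singleEnergy_le`): compare with `p^{-1/2}` times the sum over `j` of
independent single-partite fields, the `j`-th evaluated at `x_j`. Its covariance `p⁻¹ ∑ c_j ^ p`
dominates `∏ c_j` by AM-GM, because `p` is even. Its supremum splits over `j`, so the expected
supremum is `√p` times the single-partite one.

Upper bound (`multiEnergy_le`): add to the multipartite field an independent centred Gaussian of
variance `p - 1`. The covariance `∏ c_j + p - 1` dominates `∑ c_j`, that of the linear field `∑ g_j
· x_j`, because `|c_j| ≤ 1`. Comparing exponential moments, factoring over `j` and applying Jensen
gives `√p` times the lifted bound.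

Both bounds hold at every `n ≥ 1`. The second-level hypothesis says that the optimised lifted bound
tends to the single-partite energy, so the two limits meet. Slepian's lemma is proved by rotating
one process into the other and integrating by parts. -/

instance {ι : Type} [Fintype ι] : IsProbabilityMeasure (stdNormalLaw ι) := by
  unfold stdNormalLaw; infer_instance

/-! ### Gaussian integration by parts -/

/-- Gaussian integration by parts in dimension one. -/
theorem integral_id_mul_gaussianReal {f f' : ℝ → ℝ} (hf : ∀ x, HasDerivAt f (f' x) x)
    (hf' : Measurable f') {C C' : ℝ} (hC : ∀ x, |f x| ≤ C) (hC' : ∀ x, |f' x| ≤ C') :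
    ∫ x, x * f x ∂(gaussianReal 0 1) = ∫ x, f' x ∂(gaussianReal 0 1) := by
  have hfm : Measurable f := (continuous_iff_continuousAt.2 fun x => (hf x).continuousAt).measurable
  rw [integral_gaussianReal_eq_integral_smul one_ne_zero,
    integral_gaussianReal_eq_integral_smul one_ne_zero]
  have hpdf : ∀ x, gaussianPDFReal 0 1 x = (√(2 * Real.pi))⁻¹ * Real.exp (-(1 / 2) * x ^ 2) := by
    intro x; simp [gaussianPDFReal]; ring_nf; simp
  -- The density satisfies `ρ' = -x ρ`, so the formula is ordinary integration by parts against `ρ`.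
  have hd : ∀ x, HasDerivAt (gaussianPDFReal 0 1) (-x * gaussianPDFReal 0 1 x) x := by
    intro x
    have h1 : HasDerivAt (fun x : ℝ => (√(2 * Real.pi))⁻¹ * Real.exp (-(1 / 2) * x ^ 2))
        ((√(2 * Real.pi))⁻¹ * (Real.exp (-(1 / 2) * x ^ 2) * (-(1 / 2) * (2 * x)))) x := by
      have := ((hasDerivAt_pow 2 x).const_mul (-(1 / 2 : ℝ))).exp.const_mul (√(2 * Real.pi))⁻¹
      simpa using this
    rw [show gaussianPDFReal 0 1 = _ from funext hpdf]
    convert h1 using 1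
    ring
  have hint : Integrable (gaussianPDFReal 0 1) := integrable_gaussianPDFReal 0 1
  have hint1 : Integrable (fun x => -x * gaussianPDFReal 0 1 x) := by
    have := (integrable_mul_exp_neg_mul_sq (b := 1 / 2) (by norm_num)).const_mul
      (-(√(2 * Real.pi))⁻¹)
    refine this.congr (Eventually.of_forall fun x => ?_)
    simp only [hpdf]; ring
  have key := integral_mul_deriv_eq_deriv_mul_of_integrable (u := f) (u' := f')
    (v := gaussianPDFReal 0 1) (v' := fun x => -x * gaussianPDFReal 0 1 x)
    (fun x _ => hf x) (fun x _ => hd x)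
    (hint1.bdd_mul hfm.aestronglyMeasurable (Eventually.of_forall hC))
    (hint.bdd_mul hf'.aestronglyMeasurable (Eventually.of_forall hC'))
    (hint.bdd_mul hfm.aestronglyMeasurable (Eventually.of_forall hC))
  simp only [smul_eq_mul]
  rw [← neg_inj, ← integral_neg]
  calc _ = ∫ x, f x * (-x * gaussianPDFReal 0 1 x) := by congr 1; ext x; ring
    _ = _ := key
    _ = _ := by congr 2; ext x; ring

theorem _root_.MeasureTheory.MeasurePreserving.integral_comp_of_aestronglyMeasurable
    {α β : Type*} [MeasurableSpace α] [MeasurableSpace β] {μ : Measure α} {ν : Measure β}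
    {g : α → β} (hg : MeasurePreserving g μ ν) {f : β → ℝ} (hf : AEStronglyMeasurable f ν) :
    ∫ x, f (g x) ∂μ = ∫ y, f y ∂ν := by
  rw [← hg.map_eq] at hf ⊢
  exact (integral_map hg.aemeasurable hf).symm

/-- Resampling one coordinate independently does not change the law. Fubini then reduces
coordinatewise integration by parts to dimension one. -/
theorem measurePreserving_update {ι : Type} [Fintype ι] [DecidableEq ι] (k : ι) :
    MeasurePreserving (fun q : (ι → ℝ) × ℝ => Function.update q.1 k q.2)
      ((stdNormalLaw ι).prod (gaussianReal 0 1)) (stdNormalLaw ι) := by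
  have hm : Measurable (fun q : (ι → ℝ) × ℝ => Function.update q.1 k q.2) := by
    refine measurable_pi_iff.2 fun j => ?_
    by_cases h : j = k
    · subst h; simpa using measurable_snd
    · simp only [Function.update_of_ne h]; exact (measurable_pi_apply j).comp measurable_fst
  refine ⟨hm, (Measure.pi_eq fun s hs => ?_).symm⟩
  rw [Measure.map_apply hm (MeasurableSet.univ_pi hs)]
  have : (fun q : (ι → ℝ) × ℝ => Function.update q.1 k q.2) ⁻¹' (Set.univ.pi s) =
      (Set.univ.pi (Function.update s k Set.univ)) ×ˢ s k := by
    ext ⟨z, x⟩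
    simp only [Set.mem_preimage, Set.mem_pi, Set.mem_univ, true_imp_iff, Set.mem_prod]
    constructor
    · intro h
      refine ⟨fun j => ?_, by simpa using h k⟩
      by_cases hj : j = k
      · subst hj; simp
      · simpa [Function.update_of_ne hj] using h j
    · rintro ⟨h, hk⟩ j
      by_cases hj : j = k
      · subst hj; simpa using hk
      · simpa [Function.update_of_ne hj] using h j
  rw [this, Measure.prod_prod, stdNormalLaw, Measure.pi_pi, ← Finset.mul_prod_erase _ _ (Finset.mem_univ k),
    ← Finset.mul_prod_erase (a := k) (f := fun i => gaussianReal 0 1 (s i)) _ (Finset.mem_univ k)]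
  simp only [Function.update_self, measure_univ, one_mul]
  rw [mul_comm]
  congr 1
  refine Finset.prod_congr rfl fun j hj => ?_
  rw [Function.update_of_ne (Finset.ne_of_mem_erase hj)]

theorem measurePreserving_eval_stdNormalLaw {ι : Type} [Fintype ι] (k : ι) :
    MeasurePreserving (fun z : ι → ℝ => z k) (stdNormalLaw ι) (gaussianReal 0 1) :=
  measurePreserving_eval (fun _ => gaussianReal 0 1) k

theorem integrable_eval {ι : Type} [Fintype ι] (k : ι) :
    Integrable (fun z : ι → ℝ => z k) (stdNormalLaw ι) :=
  (measurePreserving_eval_stdNormalLaw k).integrable_comp_of_integrable (g := fun x => x)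
    ((memLp_id_gaussianReal 1).integrable le_rfl)

theorem integrable_dotProduct {ι : Type} [Fintype ι] (v : ι → ℝ) :
    Integrable (fun z : ι → ℝ => v ⬝ᵥ z) (stdNormalLaw ι) :=
  integrable_finsetSum _ fun k _ => (integrable_eval k).const_mul (v k)

/-- Gaussian integration by parts in a coordinate direction. -/
theorem integral_eval_mul {ι : Type} [Fintype ι] [DecidableEq ι] (k : ι) {f f' : (ι → ℝ) → ℝ}
    (hd : ∀ z x, HasDerivAt (fun x => f (Function.update z k x)) (f' (Function.update z k x)) x)
    (hf : Measurable f) (hf' : Measurable f')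
    {C C' : ℝ} (hC : ∀ z, |f z| ≤ C) (hC' : ∀ z, |f' z| ≤ C') :
    ∫ z, z k * f z ∂(stdNormalLaw ι) = ∫ z, f' z ∂(stdNormalLaw ι) := by
  have mp := measurePreserving_update k
  have i1 : Integrable (fun z => z k * f z) (stdNormalLaw ι) :=
    (integrable_eval k).mul_bdd hf.aestronglyMeasurable (Eventually.of_forall hC)
  have i2 : Integrable f' (stdNormalLaw ι) :=
    Integrable.of_bound hf'.aestronglyMeasurable C' (Eventually.of_forall hC')
  have i1' := mp.integrable_comp_of_integrable i1
  have i2' := mp.integrable_comp_of_integrable i2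
  rw [← mp.integral_comp_of_aestronglyMeasurable i1.aestronglyMeasurable,
    ← mp.integral_comp_of_aestronglyMeasurable i2.aestronglyMeasurable]
  erw [integral_prod _ i1', integral_prod _ i2']
  refine integral_congr_ae (Eventually.of_forall fun z => ?_)
  have hm : Measurable fun x : ℝ => Function.update z k x := measurable_update z
  have := integral_id_mul_gaussianReal (hd z) (hf'.comp hm) (fun x => hC _) (fun x => hC' _)
  simpa using this

/-- Gaussian integration by parts in an arbitrary direction. -/
theorem integral_dotProduct_mul {ι : Type} [Fintype ι] (v : ι → ℝ)
    {f : (ι → ℝ) → ℝ} {f' : (ι → ℝ) → (ι → ℝ) →L[ℝ] ℝ} (hd : ∀ z, HasFDerivAt f (f' z) z)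
    (hf' : Continuous f') {C C' : ℝ} (hC : ∀ z, |f z| ≤ C) (hC' : ∀ z, ‖f' z‖ ≤ C') :
    ∫ z, (v ⬝ᵥ z) * f z ∂(stdNormalLaw ι) = ∫ z, f' z v ∂(stdNormalLaw ι) := by
  classical
  have hfc : Continuous f := continuous_iff_continuousAt.2 fun z => (hd z).continuousAt
  have hev : ∀ w, Continuous fun z => f' z w := fun w => hf'.clm_apply continuous_const
  have hb : ∀ w z, |f' z w| ≤ C' * ‖w‖ := fun w z =>
    ((f' z).le_opNorm w).trans (mul_le_mul_of_nonneg_right (hC' z) (norm_nonneg _))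
  have h1 : ∀ k, ∫ z, z k * f z ∂(stdNormalLaw ι)
      = ∫ z, f' z (Pi.single k 1) ∂(stdNormalLaw ι) := fun k => by
    refine integral_eval_mul k (fun z x => ?_) hfc.measurable (hev _).measurable hC (hb _)
    exact (hd _).comp_hasDerivAt x (hasDerivAt_update z k x)
  have i1 : ∀ k, Integrable (fun z => z k * f z) (stdNormalLaw ι) := fun k =>
    (integrable_eval k).mul_bdd hfc.aestronglyMeasurable (Eventually.of_forall hC)
  have i2 : ∀ w, Integrable (fun z => f' z w) (stdNormalLaw ι) := fun w =>
    Integrable.of_bound (hev w).aestronglyMeasurable _ (Eventually.of_forall (hb w))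
  calc ∫ z, (v ⬝ᵥ z) * f z ∂(stdNormalLaw ι)
      = ∫ z, ∑ k, v k * (z k * f z) ∂(stdNormalLaw ι) := by
        congr 1; ext z; simp only [dotProduct, Finset.sum_mul, mul_assoc]
    _ = ∑ k, v k * ∫ z, f' z (Pi.single k 1) ∂(stdNormalLaw ι) := by
        rw [integral_finsetSum _ fun k _ => (i1 k).const_mul _]
        simp only [integral_const_mul, h1]
    _ = ∫ z, ∑ k, v k * f' z (Pi.single k 1) ∂(stdNormalLaw ι) := by
        rw [integral_finsetSum _ fun k _ => (i2 _).const_mul _]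
        simp only [integral_const_mul]
    _ = ∫ z, f' z v ∂(stdNormalLaw ι) := by
        congr 1; ext z
        conv_rhs => rw [pi_eq_sum_univ' v, map_sum]
        refine Finset.sum_congr rfl fun k _ => ?_
        rw [map_smul, smul_eq_mul]

/-! ### Smooth cutoffs and Gaussian interpolation -/

/-- A `C²` cutoff with values in `[0, 1]`, bounded derivatives `φ₁`, `φ₂`, and antitone. -/
structure IsSmoothCutoff (φ φ₁ φ₂ : ℝ → ℝ) (C : ℝ) : Prop where
  hasDerivAt : ∀ x, HasDerivAt φ (φ₁ x) x
  hasDerivAt' : ∀ x, HasDerivAt φ₁ (φ₂ x) x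
  continuous : Continuous φ₂
  nonneg : ∀ x, 0 ≤ φ x
  le_one : ∀ x, φ x ≤ 1
  deriv_nonpos : ∀ x, φ₁ x ≤ 0
  deriv_bound : ∀ x, |φ₁ x| ≤ C
  deriv_bound' : ∀ x, |φ₂ x| ≤ C

namespace IsSmoothCutoff

variable {φ φ₁ φ₂ : ℝ → ℝ} {C : ℝ}

theorem continuous_self (h : IsSmoothCutoff φ φ₁ φ₂ C) : Continuous φ :=
  continuous_iff_continuousAt.2 fun x => (h.hasDerivAt x).continuousAt

theorem continuous_deriv (h : IsSmoothCutoff φ φ₁ φ₂ C) : Continuous φ₁ :=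
  continuous_iff_continuousAt.2 fun x => (h.hasDerivAt' x).continuousAt

theorem bound_nonneg (h : IsSmoothCutoff φ φ₁ φ₂ C) : 0 ≤ C :=
  (abs_nonneg _).trans (h.deriv_bound 0)

theorem prod_nonneg (h : IsSmoothCutoff φ φ₁ φ₂ C) {I : Type} (s : Finset I) (x : I → ℝ) :
    0 ≤ ∏ i ∈ s, φ (x i) := Finset.prod_nonneg fun _ _ => h.nonneg _

theorem prod_le_one (h : IsSmoothCutoff φ φ₁ φ₂ C) {I : Type} (s : Finset I) (x : I → ℝ) :
    ∏ i ∈ s, φ (x i) ≤ 1 := Finset.prod_le_one (fun _ _ => h.nonneg _) fun _ _ => h.le_one _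

theorem abs_prod_le_one (h : IsSmoothCutoff φ φ₁ φ₂ C) {I : Type} (s : Finset I) (x : I → ℝ) :
    |∏ i ∈ s, φ (x i)| ≤ 1 := by
  rw [abs_of_nonneg (h.prod_nonneg s x)]; exact h.prod_le_one s x

end IsSmoothCutoff

/-- The linear functional `z ↦ v ⬝ᵥ z`. -/
noncomputable def dotCLM {ι : Type} [Fintype ι] (v : ι → ℝ) : (ι → ℝ) →L[ℝ] ℝ :=
  ∑ k, v k • ContinuousLinearMap.proj (R := ℝ) (φ := fun _ : ι => ℝ) k

@[simp] theorem dotCLM_apply {ι : Type} [Fintype ι] (v z : ι → ℝ) : dotCLM v z = v ⬝ᵥ z := by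
  simp [dotCLM, dotProduct]

theorem hasFDerivAt_dotProduct {ι : Type} [Fintype ι] (v z : ι → ℝ) :
    HasFDerivAt (fun z => v ⬝ᵥ z) (dotCLM v) z := by
  have h := (dotCLM v).hasFDerivAt (x := z)
  rwa [show ⇑(dotCLM v) = fun z => v ⬝ᵥ z from funext (dotCLM_apply v)] at h

theorem continuous_dotProduct_left {ι : Type} [Fintype ι] (v : ι → ℝ) :
    Continuous (fun z : ι → ℝ => v ⬝ᵥ z) := by
  unfold dotProduct; fun_prop

/-- Gaussian integration by parts for the gradient of a product of cutoffs. -/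
theorem integral_dotProduct_mul_cutoff {ι I : Type} [Fintype ι] [Fintype I] [DecidableEq I]
    {φ φ₁ φ₂ : ℝ → ℝ} {C : ℝ} (h : IsSmoothCutoff φ φ₁ φ₂ C) (L : I → ι → ℝ) (i : I) (v : ι → ℝ)
    (hv : v ⬝ᵥ L i = 0) :
    ∫ z, (v ⬝ᵥ z) * (φ₁ (L i ⬝ᵥ z) * ∏ j ∈ Finset.univ.erase i, φ (L j ⬝ᵥ z)) ∂(stdNormalLaw ι) =
      ∫ z, ∑ j ∈ Finset.univ.erase i, (φ₁ (L i ⬝ᵥ z) * φ₁ (L j ⬝ᵥ z) *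
        ∏ l ∈ (Finset.univ.erase i).erase j, φ (L l ⬝ᵥ z)) * (v ⬝ᵥ L j) ∂(stdNormalLaw ι) := by
  have hφ := h.continuous_self
  have hφ₁ := h.continuous_deriv
  have hφ₂ := h.continuous
  have hL : ∀ j, Continuous fun z : ι → ℝ => L j ⬝ᵥ z := fun j => continuous_dotProduct_left _
  have hC := h.bound_nonneg
  have key := integral_dotProduct_mul v
    (f := fun z => φ₁ (L i ⬝ᵥ z) * ∏ j ∈ Finset.univ.erase i, φ (L j ⬝ᵥ z))
    (f' := fun z => φ₁ (L i ⬝ᵥ z) • (∑ j ∈ Finset.univ.erase i,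
        (∏ l ∈ (Finset.univ.erase i).erase j, φ (L l ⬝ᵥ z)) • (φ₁ (L j ⬝ᵥ z) • dotCLM (L j))) +
      (∏ j ∈ Finset.univ.erase i, φ (L j ⬝ᵥ z)) • (φ₂ (L i ⬝ᵥ z) • dotCLM (L i)))
    (C := C)
    (C' := C * (∑ j ∈ Finset.univ.erase i, 1 * (C * ‖dotCLM (L j)‖)) + 1 * (C * ‖dotCLM (L i)‖))
    (fun z => by
      refine HasFDerivAt.mul ?_ ?_
      · exact (h.hasDerivAt' _).comp_hasFDerivAt z (hasFDerivAt_dotProduct _ _)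
      · exact HasFDerivAt.finsetProd fun j _ =>
          (h.hasDerivAt _).comp_hasFDerivAt z (hasFDerivAt_dotProduct _ _))
    (by fun_prop)
    (fun z => by
      rw [abs_mul]
      exact (mul_le_mul (h.deriv_bound _) (h.abs_prod_le_one _ _) (abs_nonneg _) hC).trans_eq
        (mul_one C))
    (fun z => by
      refine (norm_add_le _ _).trans (add_le_add ?_ ?_)
      · rw [norm_smul]
        refine mul_le_mul (h.deriv_bound _) ((norm_sum_le _ _).trans
          (Finset.sum_le_sum fun j _ => ?_)) (norm_nonneg _) hC
        rw [norm_smul, norm_smul]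
        exact mul_le_mul (h.abs_prod_le_one _ _) (mul_le_mul_of_nonneg_right (h.deriv_bound _)
          (norm_nonneg _)) (by positivity) zero_le_one
      · rw [norm_smul, norm_smul]
        exact mul_le_mul (h.abs_prod_le_one _ _) (mul_le_mul_of_nonneg_right (h.deriv_bound' _)
          (norm_nonneg _)) (by positivity) zero_le_one)
  rw [key]
  congr 1; ext z
  simp only [add_apply, smul_apply, sum_apply, dotCLM_apply, smul_eq_mul]
  -- The `φ₂` term carries the factor `v ⬝ᵥ L i = 0` and disappears.
  rw [dotProduct_comm (L i) v, hv, mul_zero, mul_zero, add_zero, Finset.mul_sum]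
  refine Finset.sum_congr rfl fun j _ => ?_
  rw [dotProduct_comm (L j) v]; ring

/-- Smooth form of Slepian's comparison, both processes living on the same Gaussian space and
being independent. -/
theorem integral_prod_cutoff_le {ι I : Type} [Fintype ι] [Fintype I]
    {φ φ₁ φ₂ : ℝ → ℝ} {C : ℝ} (h : IsSmoothCutoff φ φ₁ φ₂ C) (a b : I → ι → ℝ)
    (hab : ∀ i j, a i ⬝ᵥ b j = 0) (hvar : ∀ i, a i ⬝ᵥ a i = b i ⬝ᵥ b i)
    (hcov : ∀ i j, b i ⬝ᵥ b j ≤ a i ⬝ᵥ a j) :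
    ∫ z, ∏ i, φ (b i ⬝ᵥ z) ∂(stdNormalLaw ι) ≤ ∫ z, ∏ i, φ (a i ⬝ᵥ z) ∂(stdNormalLaw ι) := by
  classical
  have hφ := h.continuous_self
  have hφ₁ := h.continuous_deriv
  have hC := h.bound_nonneg
  -- Rotation from `a` at `θ = 0` to `b` at `θ = π/2`; since `a` and `b` are orthogonal with equal
  -- variances, the variances stay constant along the path.
  set L : ℝ → I → ι → ℝ := fun θ i => Real.cos θ • a i + Real.sin θ • b i with hLdef
  set L' : ℝ → I → ι → ℝ := fun θ i => -Real.sin θ • a i + Real.cos θ • b i with hL'def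
  have hLc : ∀ θ i, Continuous fun z : ι → ℝ => L θ i ⬝ᵥ z := fun _ _ =>
    continuous_dotProduct_left _
  have hL'c : ∀ θ i, Continuous fun z : ι → ℝ => L' θ i ⬝ᵥ z := fun _ _ =>
    continuous_dotProduct_left _
  have hLd : ∀ θ i z, HasDerivAt (fun θ => L θ i ⬝ᵥ z) (L' θ i ⬝ᵥ z) θ := by
    intro θ i z
    simp only [hLdef, hL'def, add_dotProduct, smul_dotProduct, smul_eq_mul]
    exact ((Real.hasDerivAt_cos θ).mul_const _).add ((Real.hasDerivAt_sin θ).mul_const _)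
  -- The diagonal case vanishes by `hvar`, which is the orthogonality that
  -- `integral_dotProduct_mul_cutoff` requires.
  have hLL : ∀ θ i j, L' θ i ⬝ᵥ L θ j =
      Real.sin θ * Real.cos θ * (b i ⬝ᵥ b j - a i ⬝ᵥ a j) := by
    intro θ i j
    simp only [hLdef, hL'def, add_dotProduct, smul_dotProduct, dotProduct_add, dotProduct_smul,
      smul_eq_mul, hab, dotProduct_comm (b i) (a j)]
    ring
  set Φ : ℝ → ℝ := fun θ => ∫ z, ∏ i, φ (L θ i ⬝ᵥ z) ∂(stdNormalLaw ι) with hΦ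
  set D : ℝ → (ι → ℝ) → ℝ := fun θ z => ∑ i, (∏ j ∈ Finset.univ.erase i, φ (L θ j ⬝ᵥ z)) •
    (φ₁ (L θ i ⬝ᵥ z) * (L' θ i ⬝ᵥ z)) with hD
  have hΦd : ∀ θ, HasDerivAt Φ (∫ z, D θ z ∂(stdNormalLaw ι)) θ := by
    intro θ
    refine (hasDerivAt_integral_of_dominated_loc_of_deriv_le (F' := D)
      (bound := fun z => ∑ i, 1 * (C * (|a i ⬝ᵥ z| + |b i ⬝ᵥ z|))) univ_mem
      (Eventually.of_forall fun θ => ?_) ?_ ?_ ?_ ?_ ?_).2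
    · exact (by fun_prop : Continuous fun z => ∏ i, φ (L θ i ⬝ᵥ z)).aestronglyMeasurable
    · exact Integrable.of_bound
        (by fun_prop : Continuous fun z => ∏ i, φ (L θ i ⬝ᵥ z)).aestronglyMeasurable 1
        (Eventually.of_forall fun z => h.abs_prod_le_one _ _)
    · exact (by fun_prop : Continuous (D θ)).aestronglyMeasurable
    · refine Eventually.of_forall fun z θ _ => ?_
      refine (norm_sum_le _ _).trans (Finset.sum_le_sum fun i _ => ?_)
      rw [norm_smul, norm_mul]
      refine mul_le_mul (h.abs_prod_le_one _ _) (mul_le_mul (h.deriv_bound _) ?_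
        (norm_nonneg _) hC) (by positivity) zero_le_one
      simp only [hL'def, add_dotProduct, smul_dotProduct, smul_eq_mul]
      refine (norm_add_le _ _).trans (add_le_add ?_ ?_)
      · rw [norm_mul, norm_neg]
        exact mul_le_of_le_one_left (norm_nonneg _) (Real.abs_sin_le_one θ)
      · rw [norm_mul]
        exact mul_le_of_le_one_left (norm_nonneg _) (Real.abs_cos_le_one θ)
    · exact integrable_finsetSum _ fun i _ => (((integrable_dotProduct (a i)).abs.add
        (integrable_dotProduct (b i)).abs).const_mul C).const_mul 1
    · exact Eventually.of_forall fun z θ _ => HasDerivAt.fun_finsetProd fun i _ =>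
        (h.hasDerivAt _).comp θ (hLd θ i z)
  have hneg : ∀ θ ∈ Set.Icc 0 (Real.pi / 2), ∫ z, D θ z ∂(stdNormalLaw ι) ≤ 0 := by
    intro θ hθ
    have hsc : 0 ≤ Real.sin θ * Real.cos θ :=
      mul_nonneg (Real.sin_nonneg_of_nonneg_of_le_pi hθ.1 (by linarith [hθ.2, Real.pi_pos]))
        (Real.cos_nonneg_of_mem_Icc ⟨by linarith [hθ.1, Real.pi_pos], hθ.2⟩)
    have hint : ∀ i, Integrable (fun z => (∏ j ∈ Finset.univ.erase i, φ (L θ j ⬝ᵥ z)) •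
        (φ₁ (L θ i ⬝ᵥ z) * (L' θ i ⬝ᵥ z))) (stdNormalLaw ι) := fun i =>
      ((integrable_dotProduct (L' θ i)).bdd_mul
        (by fun_prop : Continuous fun z => φ₁ (L θ i ⬝ᵥ z)).aestronglyMeasurable
        (Eventually.of_forall fun z => h.deriv_bound _)).bdd_mul
        (by fun_prop : Continuous fun z =>
          ∏ j ∈ Finset.univ.erase i, φ (L θ j ⬝ᵥ z)).aestronglyMeasurable
        (Eventually.of_forall fun z => h.abs_prod_le_one _ _)
    rw [hD, integral_finsetSum _ fun i _ => hint i]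
    refine Finset.sum_nonpos fun i _ => ?_
    have e := integral_dotProduct_mul_cutoff h (L θ) i (L' θ i) (by rw [hLL, hvar]; ring)
    have e' : ∫ z, (∏ j ∈ Finset.univ.erase i, φ (L θ j ⬝ᵥ z)) •
        (φ₁ (L θ i ⬝ᵥ z) * (L' θ i ⬝ᵥ z)) ∂(stdNormalLaw ι) = ∫ z, (L' θ i ⬝ᵥ z) *
        (φ₁ (L θ i ⬝ᵥ z) * ∏ j ∈ Finset.univ.erase i, φ (L θ j ⬝ᵥ z)) ∂(stdNormalLaw ι) := by
      congr 1; ext z; rw [smul_eq_mul]; ring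
    rw [e', e]
    -- Two nonpositive derivatives multiply to a nonnegative factor, so the sign is that of `b i ⬝ᵥ
    -- b j - a i ⬝ᵥ a j`.
    refine integral_nonpos fun z => Finset.sum_nonpos fun j _ => mul_nonpos_of_nonneg_of_nonpos
      (mul_nonneg (mul_nonneg_of_nonpos_of_nonpos (h.deriv_nonpos _) (h.deriv_nonpos _))
        (h.prod_nonneg _ _)) ?_
    rw [hLL]
    exact mul_nonpos_of_nonneg_of_nonpos hsc (sub_nonpos.2 (hcov i j))
  have hanti : AntitoneOn Φ (Set.Icc 0 (Real.pi / 2)) :=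
    antitoneOn_of_deriv_nonpos (convex_Icc _ _)
      (fun θ _ => (hΦd θ).continuousAt.continuousWithinAt)
      (fun θ _ => (hΦd θ).differentiableAt.differentiableWithinAt)
      (fun θ hθ => by rw [(hΦd θ).deriv]; exact hneg θ (interior_subset hθ))
  have hpi := Real.pi_pos
  have := hanti (a := 0) (b := Real.pi / 2) ⟨le_rfl, by positivity⟩ ⟨by positivity, le_rfl⟩
    (by positivity)
  simpa [hΦ, hLdef] using this

/-- Smooth cutoffs approximating the indicator of `(-∞, u]`. -/
theorem exists_isSmoothCutoff (u : ℝ) {ε : ℝ} (hε : 0 < ε) : ∃ φ φ₁ φ₂ : ℝ → ℝ, ∃ C,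
    IsSmoothCutoff φ φ₁ φ₂ C ∧ (∀ x ≤ u, φ x = 1) ∧ ∀ x, u + ε ≤ x → φ x = 0 := by
  set φ : ℝ → ℝ := fun x => Real.smoothTransition ((u + ε - x) / ε) with hφ
  have hone : ∀ x ≤ u, φ x = 1 := fun x hx =>
    Real.smoothTransition.one_of_one_le ((one_le_div hε).2 (by linarith))
  have hzero : ∀ x, u + ε ≤ x → φ x = 0 := fun x hx =>
    Real.smoothTransition.zero_of_nonpos (div_nonpos_of_nonpos_of_nonneg (by linarith) hε.le)
  have hsm : ContDiff ℝ 2 φ :=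
    (Real.smoothTransition.contDiff (n := 2)).comp
      ((contDiff_const.sub contDiff_id).div_const _)
  have hsm1 : ContDiff ℝ 1 (deriv φ) := hsm.deriv' (n := 1)
  have hsm2 : Continuous (deriv (deriv φ)) := hsm1.continuous_deriv le_rfl
  have off : ∀ x, x ∉ Set.Icc u (u + ε) → deriv φ x = 0 := by
    intro x hx
    rcases lt_or_ge x u with h | h
    · have : φ =ᶠ[𝓝 x] fun _ => 1 := by
        filter_upwards [eventually_lt_nhds h] with y hy using hone y hy.le
      rw [this.deriv_eq]; simp
    · have h' : u + ε < x := not_le.1 fun h' => hx ⟨h, h'⟩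
      have : φ =ᶠ[𝓝 x] fun _ => 0 := by
        filter_upwards [eventually_gt_nhds h'] with y hy using hzero y hy.le
      rw [this.deriv_eq]; simp
  have off' : ∀ x, x ∉ Set.Icc u (u + ε) → deriv (deriv φ) x = 0 := by
    intro x hx
    have : deriv φ =ᶠ[𝓝 x] fun _ => 0 := by
      filter_upwards [isClosed_Icc.isOpen_compl.mem_nhds hx] with y hy using off y hy
    rw [this.deriv_eq]; simp
  have bdd : ∀ f : ℝ → ℝ, Continuous f → (∀ x, x ∉ Set.Icc u (u + ε) → f x = 0) →
      ∃ C, 0 ≤ C ∧ ∀ x, |f x| ≤ C := by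
    intro f hf h0
    obtain ⟨C, hC⟩ := isCompact_Icc.exists_bound_of_continuousOn (s := Set.Icc u (u + ε))
      hf.continuousOn
    refine ⟨max C 0, le_max_right _ _, fun x => ?_⟩
    by_cases hx : x ∈ Set.Icc u (u + ε)
    · exact (hC x hx).trans (le_max_left _ _)
    · rw [h0 x hx, abs_zero]; exact le_max_right _ _
  obtain ⟨C₁, h₁, hC₁⟩ := bdd _ hsm1.continuous off
  obtain ⟨C₂, h₂, hC₂⟩ := bdd _ hsm2 off'
  have hanti : Antitone φ := fun x y hxy =>
    Real.smoothTransition.monotone (by gcongr)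
  refine ⟨φ, deriv φ, deriv (deriv φ), C₁ + C₂, ⟨?_, ?_, hsm2, ?_, ?_, ?_, ?_, ?_⟩, hone, hzero⟩
  · exact fun x => (hsm.differentiable (by norm_num) x).hasDerivAt
  · exact fun x => (hsm1.differentiable (by norm_num) x).hasDerivAt
  · exact fun x => Real.smoothTransition.nonneg _
  · exact fun x => Real.smoothTransition.le_one _
  · exact fun x => hanti.deriv_nonpos
  · exact fun x => (hC₁ x).trans (by linarith)
  · exact fun x => (hC₂ x).trans (by linarith)

/-! ### Slepian's lemma -/

theorem measurePreserving_comp_injective {ι κ : Type} [Fintype ι] [Fintype κ] {e : ι → κ}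
    (he : Function.Injective e) :
    MeasurePreserving (fun z : κ → ℝ => z ∘ e) (stdNormalLaw κ) (stdNormalLaw ι) := by
  classical
  have hm : Measurable (fun z : κ → ℝ => z ∘ e) :=
    measurable_pi_iff.2 fun i => measurable_pi_apply (e i)
  refine ⟨hm, (Measure.pi_eq fun s hs => ?_).symm⟩
  rw [Measure.map_apply hm (MeasurableSet.univ_pi hs)]
  have : (fun z : κ → ℝ => z ∘ e) ⁻¹' (Set.univ.pi s) =
      Set.univ.pi (Function.extend e s fun _ => Set.univ) := by
    ext z
    simp only [Set.mem_preimage, Set.mem_pi, Set.mem_univ, true_imp_iff, Function.comp]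
    constructor
    · intro h k
      by_cases hk : ∃ i, e i = k
      · obtain ⟨i, rfl⟩ := hk
        rw [he.extend_apply]; exact h i
      · rw [Function.extend_apply' _ _ _ hk]; trivial
    · intro h i
      have := h (e i)
      rwa [he.extend_apply] at this
  rw [this, stdNormalLaw, Measure.pi_pi]
  have h1 : ∀ k, k ∉ Finset.univ.image e →
      gaussianReal 0 1 (Function.extend e s (fun _ => Set.univ) k) = 1 := by
    intro k hk
    rw [Function.extend_apply' _ _ _ (by simpa using hk), measure_univ]
  rw [← Finset.prod_subset (Finset.subset_univ (Finset.univ.image e)) fun k _ hk => h1 k hk,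
    Finset.prod_image fun i _ j _ h => he h]
  exact Finset.prod_congr rfl fun i _ => by rw [he.extend_apply]

theorem measurableSet_forall_dotProduct_le {ι T : Type} [Fintype ι] (a : T → ι → ℝ) (u : ℝ) :
    MeasurableSet {z : ι → ℝ | ∀ t, a t ⬝ᵥ z ≤ u} := by
  rw [Set.ofPred_forall]
  exact (isClosed_iInter fun t =>
    isClosed_le (continuous_dotProduct_left _) continuous_const).measurableSet

/-- Slepian's lemma for finitely many Gaussian variables given as linear functionals of standard
normal vectors. -/
theorem slepian_finite {ι κ I : Type} [Fintype ι] [Fintype κ] [Fintype I]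
    (a : I → ι → ℝ) (b : I → κ → ℝ) (hvar : ∀ i, a i ⬝ᵥ a i = b i ⬝ᵥ b i)
    (hcov : ∀ i j, b i ⬝ᵥ b j ≤ a i ⬝ᵥ a j) (u : ℝ) :
    stdNormalLaw κ {z | ∀ i, b i ⬝ᵥ z ≤ u} ≤ stdNormalLaw ι {z | ∀ i, a i ⬝ᵥ z ≤ u} := by
  have step : ∀ ε > 0, stdNormalLaw κ {z | ∀ i, b i ⬝ᵥ z ≤ u} ≤
      stdNormalLaw ι {z | ∀ i, a i ⬝ᵥ z ≤ u + ε} := by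
    intro ε hε
    obtain ⟨φ, φ₁, φ₂, C, h, h1, h0⟩ := exists_isSmoothCutoff u hε
    have hφ := h.continuous_self
    -- Disjoint blocks of coordinates make the two processes independent on one Gaussian space.
    have key := integral_prod_cutoff_le (ι := ι ⊕ κ) h (fun i => Sum.elim (a i) 0)
      (fun i => Sum.elim 0 (b i)) (fun i j => by simp [dotProduct])
      (fun i => by simpa [dotProduct] using hvar i)
      (fun i j => by simpa [dotProduct] using hcov i j)
    have ea : ∀ i (z : ι ⊕ κ → ℝ), Sum.elim (a i) 0 ⬝ᵥ z = a i ⬝ᵥ (z ∘ Sum.inl) := by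
      intro i z; simp [dotProduct]
    have eb : ∀ i (z : ι ⊕ κ → ℝ), Sum.elim 0 (b i) ⬝ᵥ z = b i ⬝ᵥ (z ∘ Sum.inr) := by
      intro i z; simp [dotProduct]
    simp only [ea, eb] at key
    have ca : Continuous fun z : ι → ℝ => ∏ i, φ (a i ⬝ᵥ z) :=
      continuous_finsetProd _ fun i _ => hφ.comp (continuous_dotProduct_left _)
    have cb : Continuous fun z : κ → ℝ => ∏ i, φ (b i ⬝ᵥ z) :=
      continuous_finsetProd _ fun i _ => hφ.comp (continuous_dotProduct_left _)
    rw [(measurePreserving_comp_injective (ι := κ) (κ := ι ⊕ κ)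
        Sum.inr_injective).integral_comp_of_aestronglyMeasurable
        (f := fun z => ∏ i, φ (b i ⬝ᵥ z)) cb.aestronglyMeasurable,
      (measurePreserving_comp_injective (ι := ι) (κ := ι ⊕ κ)
        Sum.inl_injective).integral_comp_of_aestronglyMeasurable
        (f := fun z => ∏ i, φ (a i ⬝ᵥ z)) ca.aestronglyMeasurable] at key
    have ia : Integrable (fun z : ι → ℝ => ∏ i, φ (a i ⬝ᵥ z)) (stdNormalLaw ι) :=
      Integrable.of_bound ca.aestronglyMeasurable 1
        (Eventually.of_forall fun z => h.abs_prod_le_one _ _)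
    have ib : Integrable (fun z : κ → ℝ => ∏ i, φ (b i ⬝ᵥ z)) (stdNormalLaw κ) :=
      Integrable.of_bound cb.aestronglyMeasurable 1
        (Eventually.of_forall fun z => h.abs_prod_le_one _ _)
    have mb := measurableSet_forall_dotProduct_le b u
    have ma := measurableSet_forall_dotProduct_le a (u + ε)
    have lb : (stdNormalLaw κ).real {z | ∀ i, b i ⬝ᵥ z ≤ u} ≤
        ∫ z, ∏ i, φ (b i ⬝ᵥ z) ∂(stdNormalLaw κ) := by
      rw [← integral_indicator_one mb]
      refine integral_mono ((integrable_const 1).indicator mb) ib fun z => ?_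
      by_cases hz : z ∈ {z | ∀ i, b i ⬝ᵥ z ≤ u}
      · rw [Set.indicator_of_mem hz, Finset.prod_eq_one fun i _ => h1 _ (hz i)]; rfl
      · rw [Set.indicator_of_notMem hz]; exact h.prod_nonneg _ _
    have la : ∫ z, ∏ i, φ (a i ⬝ᵥ z) ∂(stdNormalLaw ι) ≤
        (stdNormalLaw ι).real {z | ∀ i, a i ⬝ᵥ z ≤ u + ε} := by
      rw [← integral_indicator_one ma]
      refine integral_mono ia ((integrable_const 1).indicator ma) fun z => ?_
      by_cases hz : z ∈ {z | ∀ i, a i ⬝ᵥ z ≤ u + ε}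
      · rw [Set.indicator_of_mem hz]; exact h.prod_le_one _ _
      · rw [Set.indicator_of_notMem hz]
        simp only [Set.mem_ofPred_eq, not_forall, not_le] at hz
        obtain ⟨i, hi⟩ := hz
        exact (Finset.prod_eq_zero (Finset.mem_univ i) (h0 _ hi.le)).le
    exact (ENNReal.toReal_le_toReal (by finiteness) (by finiteness)).1
      (lb.trans (key.trans la))
  -- The loss `ε` is removed by continuity from above along `ε = 1 / (n + 1)`.
  have hlim := tendsto_measure_iInter_atTop (μ := stdNormalLaw ι)
    (s := fun n : ℕ => {z | ∀ i, a i ⬝ᵥ z ≤ u + 1 / ((n : ℝ) + 1)})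
    (fun n => (measurableSet_forall_dotProduct_le a _).nullMeasurableSet)
    (fun m n hmn z hz i => (hz i).trans (by
      have : 1 / ((n : ℝ) + 1) ≤ 1 / ((m : ℝ) + 1) := Nat.one_div_le_one_div hmn
      linarith)) ⟨0, by finiteness⟩
  have : (⋂ n : ℕ, {z : ι → ℝ | ∀ i, a i ⬝ᵥ z ≤ u + 1 / ((n : ℝ) + 1)}) =
      {z | ∀ i, a i ⬝ᵥ z ≤ u} := by
    ext z
    simp only [Set.mem_iInter, Set.mem_ofPred_eq]
    refine ⟨fun h i => ?_, fun h n i => (h i).trans (by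
      have : 0 < 1 / ((n : ℝ) + 1) := Nat.one_div_pos_of_nat
      linarith)⟩
    have := (tendsto_const_nhds (x := u)).add (tendsto_one_div_add_atTop_nhds_zero_nat (𝕜 := ℝ))
    rw [add_zero] at this
    exact ge_of_tendsto' this fun n => h n i
  rw [this] at hlim
  exact ge_of_tendsto' hlim fun n => step _ Nat.one_div_pos_of_nat

/-- Slepian's lemma for separable index sets. -/
theorem slepian {ι κ T : Type} [Fintype ι] [Fintype κ] [TopologicalSpace T]
    [TopologicalSpace.SeparableSpace T] [Nonempty T]
    (a : T → ι → ℝ) (b : T → κ → ℝ) (ha : Continuous a) (hvar : ∀ t, a t ⬝ᵥ a t = b t ⬝ᵥ b t)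
    (hcov : ∀ s t, b s ⬝ᵥ b t ≤ a s ⬝ᵥ a t) (u : ℝ) :
    stdNormalLaw κ {z | ∀ t, b t ⬝ᵥ z ≤ u} ≤ stdNormalLaw ι {z | ∀ t, a t ⬝ᵥ z ≤ u} := by
  set d : ℕ → T := TopologicalSpace.denseSeq T
  have hlim := tendsto_measure_iInter_atTop (μ := stdNormalLaw ι)
    (s := fun n : ℕ => {z | ∀ i : Fin n, a (d i) ⬝ᵥ z ≤ u})
    (fun n => (measurableSet_forall_dotProduct_le _ _).nullMeasurableSet)
    (fun m n hmn z hz i => hz (Fin.castLE hmn i)) ⟨0, by finiteness⟩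
  have : (⋂ n : ℕ, {z : ι → ℝ | ∀ i : Fin n, a (d i) ⬝ᵥ z ≤ u}) = {z | ∀ t, a t ⬝ᵥ z ≤ u} := by
    ext z
    simp only [Set.mem_iInter, Set.mem_ofPred_eq]
    refine ⟨fun h t => ?_, fun h n i => h _⟩
    have hc : Continuous fun t => a t ⬝ᵥ z := by
      simp only [dotProduct]; fun_prop
    have hcl : IsClosed {t | a t ⬝ᵥ z ≤ u} := isClosed_le hc continuous_const
    have : closure (Set.range d) ⊆ {t | a t ⬝ᵥ z ≤ u} := hcl.closure_subset_iff.2 (by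
      rintro _ ⟨n, rfl⟩
      exact h (n + 1) (Fin.last n))
    exact this (TopologicalSpace.denseRange_denseSeq T t)
  rw [this] at hlim
  refine ge_of_tendsto' hlim fun n => ?_
  -- Only the `a` side needs continuity: for `b`, restricting to finitely many indices just enlarges
  -- the event.
  refine (measure_mono fun z (hz : ∀ t, b t ⬝ᵥ z ≤ u) (i : Fin n) => hz (d i)).trans ?_
  exact slepian_finite (fun i : Fin n => a (d i)) (fun i => b (d i)) (fun i => hvar _)
    (fun i j => hcov _ _) u

/-! ### From distribution functions to expectations -/

/-- Stochastic domination implies domination of expectations. -/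
theorem integral_le_integral_of_measure_le {α β : Type} [MeasurableSpace α] [MeasurableSpace β]
    {μ : Measure α} {ν : Measure β} [IsProbabilityMeasure μ] [IsProbabilityMeasure ν]
    {X : α → ℝ} {Y : β → ℝ} (hX : Integrable X μ) (hY : Integrable Y ν)
    (hXm : Measurable X) (hYm : Measurable Y)
    (h : ∀ u, ν {y | Y y ≤ u} ≤ μ {x | X x ≤ u}) : ∫ x, X x ∂μ ≤ ∫ y, Y y ∂ν := by
  have h' : ∀ u, μ {x | u < X x} ≤ ν {y | u < Y y} := by
    intro u
    have e1 : {x | u < X x} = {x | X x ≤ u}ᶜ := by ext; simp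
    have e2 : {y | u < Y y} = {y | Y y ≤ u}ᶜ := by ext; simp
    rw [e1, e2, prob_compl_eq_one_sub (measurableSet_le hXm measurable_const),
      prob_compl_eq_one_sub (measurableSet_le hYm measurable_const)]
    exact tsub_le_tsub_left (h u) 1
  -- Layer-cake formulas for the positive and negative parts; for `t > 0` the truncation at `0` does
  -- not affect the level sets.
  have pos : ∀ {γ : Type} [MeasurableSpace γ] (ρ : Measure γ) (f : γ → ℝ), Measurable f →
      ∫⁻ x, ENNReal.ofReal (f x) ∂ρ = ∫⁻ t in Set.Ioi (0 : ℝ), ρ {x | t < f x} := by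
    intro γ _ ρ f hf
    have := lintegral_eq_lintegral_meas_lt ρ (f := fun x => max (f x) 0)
      (Eventually.of_forall fun x => le_max_right _ _) (hf.max measurable_const).aemeasurable
    simp only [ENNReal.ofReal_max, ENNReal.ofReal_zero, zero_le, sup_of_le_left] at this
    rw [this]
    refine setLIntegral_congr_fun measurableSet_Ioi fun t ht => ?_
    congr 1; ext x
    simp [(Set.mem_Ioi.1 ht).not_gt]
  have neg : ∀ {γ : Type} [MeasurableSpace γ] (ρ : Measure γ) (f : γ → ℝ), Measurable f →
      ∫⁻ x, ENNReal.ofReal (-f x) ∂ρ = ∫⁻ t in Set.Ioi (0 : ℝ), ρ {x | f x ≤ -t} := by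
    intro γ _ ρ f hf
    have := lintegral_eq_lintegral_meas_le ρ (f := fun x => max (-f x) 0)
      (Eventually.of_forall fun x => le_max_right _ _) (hf.neg.max measurable_const).aemeasurable
    simp only [ENNReal.ofReal_max, ENNReal.ofReal_zero, zero_le, sup_of_le_left] at this
    rw [this]
    refine setLIntegral_congr_fun measurableSet_Ioi fun t ht => ?_
    congr 1; ext x
    simp [(Set.mem_Ioi.1 ht).not_ge, le_neg]
  rw [integral_eq_lintegral_pos_part_sub_lintegral_neg_part hX,
    integral_eq_lintegral_pos_part_sub_lintegral_neg_part hY]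
  refine sub_le_sub (ENNReal.toReal_mono hY.lintegral_lt_top.ne ?_)
    (ENNReal.toReal_mono hX.neg.lintegral_lt_top.ne ?_)
  · rw [pos μ X hXm, pos ν Y hYm]
    exact lintegral_mono fun t => h' t
  · rw [neg μ X hXm, neg ν Y hYm]
    exact lintegral_mono fun t => h (-t)

/-! ### Suprema of Gaussian processes and their comparison -/

/-- Supremum of a Gaussian process given as a family of linear functionals. -/
noncomputable def gsup {ι T : Type} [Fintype ι] (a : T → ι → ℝ) (z : ι → ℝ) : ℝ :=
  ⨆ t, a t ⬝ᵥ z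

section gsup

variable {ι T : Type} [Fintype ι] {a : T → ι → ℝ} {R : ℝ}

theorem abs_dotProduct_le (hR : ∀ t k, |a t k| ≤ R) (t : T) (z : ι → ℝ) :
    |a t ⬝ᵥ z| ≤ ∑ k, R * |z k| :=
  (Finset.abs_sum_le_sum_abs _ _).trans (Finset.sum_le_sum fun k _ => by
    rw [abs_mul]; exact mul_le_mul_of_nonneg_right (hR t k) (abs_nonneg _))

theorem bddAbove_dotProduct (hR : ∀ t k, |a t k| ≤ R) (z : ι → ℝ) :
    BddAbove (Set.range fun t => a t ⬝ᵥ z) :=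
  ⟨_, by rintro _ ⟨t, rfl⟩; exact (le_abs_self _).trans (abs_dotProduct_le hR t z)⟩

variable [Nonempty T]

theorem gsup_le_iff (hR : ∀ t k, |a t k| ≤ R) (z : ι → ℝ) (u : ℝ) :
    gsup a z ≤ u ↔ ∀ t, a t ⬝ᵥ z ≤ u :=
  ciSup_le_iff (bddAbove_dotProduct hR z)

theorem abs_gsup_le (hR : ∀ t k, |a t k| ≤ R) (z : ι → ℝ) : |gsup a z| ≤ ∑ k, R * |z k| := by
  refine abs_le.2 ⟨?_, (gsup_le_iff hR z _).2 fun t =>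
    (le_abs_self _).trans (abs_dotProduct_le hR t z)⟩
  let t := Classical.arbitrary T
  exact (abs_le.1 (abs_dotProduct_le hR t z)).1.trans (le_ciSup (bddAbove_dotProduct hR z) t)

theorem measurable_gsup (hR : ∀ t k, |a t k| ≤ R) : Measurable (gsup a) := by
  refine measurable_of_Iic fun u => ?_
  have : gsup a ⁻¹' Set.Iic u = {z | ∀ t, a t ⬝ᵥ z ≤ u} := by
    ext z; exact gsup_le_iff hR z u
  rw [this]
  exact measurableSet_forall_dotProduct_le a u

theorem integrable_gsup (hR : ∀ t k, |a t k| ≤ R) : Integrable (gsup a) (stdNormalLaw ι) :=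
  (integrable_finsetSum Finset.univ fun k _ => (integrable_eval k).abs.const_mul R).mono'
    (measurable_gsup hR).aestronglyMeasurable (Eventually.of_forall fun z => abs_gsup_le hR z)

/-- The exponential is dominated by a product of one-variable functions `exp (|c| R |z k|)`, each
integrable. -/
theorem integrable_exp_gsup (hR : ∀ t k, |a t k| ≤ R) (c : ℝ) :
    Integrable (fun z => Real.exp (c * gsup a z)) (stdNormalLaw ι) := by
  have h1 : Integrable (fun x : ℝ => Real.exp (|c| * R * |x|)) (gaussianReal 0 1) :=
    integrable_exp_mul_abs (integrable_exp_mul_gaussianReal _) (integrable_exp_mul_gaussianReal _)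
  have h2 : Integrable (fun z : ι → ℝ => ∏ k, Real.exp (|c| * R * |z k|)) (stdNormalLaw ι) :=
    Integrable.fintype_prod fun _ => h1
  refine h2.mono' (Real.measurable_exp.comp
    ((measurable_gsup hR).const_mul c)).aestronglyMeasurable (Eventually.of_forall fun z => ?_)
  rw [Real.norm_eq_abs, Real.abs_exp, ← Real.exp_sum]
  refine Real.exp_le_exp.2 ((le_abs_self _).trans ?_)
  rw [abs_mul]
  refine (mul_le_mul_of_nonneg_left (abs_gsup_le hR z) (abs_nonneg c)).trans_eq ?_
  rw [Finset.mul_sum]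
  exact Finset.sum_congr rfl fun k _ => (mul_assoc _ _ _).symm

end gsup

section comparison

variable {ι κ T : Type} [Fintype ι] [Fintype κ] [TopologicalSpace T]
    [TopologicalSpace.SeparableSpace T] [Nonempty T] {a : T → ι → ℝ} {b : T → κ → ℝ} {R R' : ℝ}

theorem measure_gsup_le (hR : ∀ t k, |a t k| ≤ R) (hR' : ∀ t k, |b t k| ≤ R')
    (ha : Continuous a) (hvar : ∀ t, a t ⬝ᵥ a t = b t ⬝ᵥ b t)
    (hcov : ∀ s t, b s ⬝ᵥ b t ≤ a s ⬝ᵥ a t) (u : ℝ) :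
    stdNormalLaw κ {z | gsup b z ≤ u} ≤ stdNormalLaw ι {z | gsup a z ≤ u} := by
  simp only [gsup_le_iff hR, gsup_le_iff hR']
  exact slepian a b ha hvar hcov u

theorem integral_gsup_le (hR : ∀ t k, |a t k| ≤ R) (hR' : ∀ t k, |b t k| ≤ R')
    (ha : Continuous a) (hvar : ∀ t, a t ⬝ᵥ a t = b t ⬝ᵥ b t)
    (hcov : ∀ s t, b s ⬝ᵥ b t ≤ a s ⬝ᵥ a t) :
    ∫ z, gsup a z ∂(stdNormalLaw ι) ≤ ∫ z, gsup b z ∂(stdNormalLaw κ) :=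
  integral_le_integral_of_measure_le (integrable_gsup hR) (integrable_gsup hR')
    (measurable_gsup hR) (measurable_gsup hR') (measure_gsup_le hR hR' ha hvar hcov)

theorem integral_exp_gsup_le (hR : ∀ t k, |a t k| ≤ R) (hR' : ∀ t k, |b t k| ≤ R')
    (ha : Continuous a) (hvar : ∀ t, a t ⬝ᵥ a t = b t ⬝ᵥ b t)
    (hcov : ∀ s t, b s ⬝ᵥ b t ≤ a s ⬝ᵥ a t) {c : ℝ} (hc : 0 < c) :
    ∫ z, Real.exp (c * gsup a z) ∂(stdNormalLaw ι) ≤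
      ∫ z, Real.exp (c * gsup b z) ∂(stdNormalLaw κ) := by
  refine integral_le_integral_of_measure_le (integrable_exp_gsup hR c)
    (integrable_exp_gsup hR' c) (Real.measurable_exp.comp ((measurable_gsup hR).const_mul c))
    (Real.measurable_exp.comp ((measurable_gsup hR').const_mul c)) fun u => ?_
  rcases le_or_gt u 0 with hu | hu
  · have : {y : κ → ℝ | Real.exp (c * gsup b y) ≤ u} = ∅ := by
      ext y; simpa using hu.trans_lt (Real.exp_pos _)
    rw [this, measure_empty]; exact zero_le
  · have e : ∀ x, Real.exp (c * x) ≤ u ↔ x ≤ Real.log u / c := fun x => by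
      rw [← Real.le_log_iff_exp_le hu, le_div_iff₀ hc, mul_comm]
    simp only [e]
    exact measure_gsup_le hR hR' ha hvar hcov _

end comparison

/-! ### Product laws and scalar inequalities -/

theorem abs_le_sqrt_dotProduct_self {ι : Type} [Fintype ι] (v : ι → ℝ) (k : ι) :
    |v k| ≤ √(v ⬝ᵥ v) := by
  refine Real.abs_le_sqrt ?_
  rw [sq]
  exact Finset.single_le_sum (f := fun i => v i * v i) (fun i _ => mul_self_nonneg _)
    (Finset.mem_univ k)

theorem abs_le_sqrt_of_dotProduct_self_eq {ι T : Type} [Fintype ι] {a : T → ι → ℝ} {v : ℝ}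
    (h : ∀ t, a t ⬝ᵥ a t = v) (t : T) (k : ι) : |a t k| ≤ √v :=
  h t ▸ abs_le_sqrt_dotProduct_self (a t) k

theorem measurePreserving_uncurry {ι κ : Type} [Fintype ι] [Fintype κ] :
    MeasurePreserving (fun (ζ : ι → κ → ℝ) (q : ι × κ) => ζ q.1 q.2)
      (Measure.pi fun _ => stdNormalLaw κ) (stdNormalLaw (ι × κ)) := by
  have hm : Measurable (fun (ζ : ι → κ → ℝ) (q : ι × κ) => ζ q.1 q.2) := by fun_prop
  refine ⟨hm, (Measure.pi_eq fun s hs => ?_).symm⟩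
  rw [Measure.map_apply hm (MeasurableSet.univ_pi hs)]
  have : (fun (ζ : ι → κ → ℝ) (q : ι × κ) => ζ q.1 q.2) ⁻¹' (Set.univ.pi s) =
      Set.univ.pi fun j => Set.univ.pi fun k => s (j, k) := by
    ext ζ
    simp only [Set.mem_preimage, Set.mem_pi, Set.mem_univ, true_imp_iff, Prod.forall]
  rw [this, Measure.pi_pi, Fintype.prod_prod_type]
  simp only [stdNormalLaw, Measure.pi_pi]

theorem integral_prod_blocks {ι κ : Type} [Fintype ι] [Fintype κ] {f : (κ → ℝ) → ℝ}
    (hf : Measurable f) :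
    ∫ z, ∏ j : ι, f (fun k => z (j, k)) ∂(stdNormalLaw (ι × κ)) =
      (∫ w, f w ∂(stdNormalLaw κ)) ^ Fintype.card ι := by
  rw [← integral_fintype_prod_eq_pow, ← measurePreserving_uncurry.integral_comp_of_aestronglyMeasurable]
  exact (Finset.measurable_fun_prod _ fun j _ => hf.comp (by fun_prop)).aestronglyMeasurable

theorem integral_mul_sum {ι κ : Type} [Fintype ι] [Fintype κ] (f : (ι → ℝ) → ℝ)
    (g : (κ → ℝ) → ℝ) :
    ∫ z, f (z ∘ Sum.inl) * g (z ∘ Sum.inr) ∂(stdNormalLaw (ι ⊕ κ)) =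
      (∫ z, f z ∂(stdNormalLaw ι)) * ∫ z, g z ∂(stdNormalLaw κ) := by
  rw [← integral_prod_mul]
  exact (measurePreserving_sumPiEquivProdPi fun _ : ι ⊕ κ => gaussianReal 0 1).integral_comp'
    (fun q : (ι → ℝ) × (κ → ℝ) => f q.1 * g q.2)

theorem integral_exp_mul_eval {ι : Type} [Fintype ι] (k : ι) (t : ℝ) :
    ∫ z : ι → ℝ, Real.exp (t * z k) ∂(stdNormalLaw ι) = Real.exp (t ^ 2 / 2) := by
  have := mgf_gaussianReal (measurePreserving_eval_stdNormalLaw k).map_eq t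
  simpa [mgf] using this

theorem exp_integral_le {α : Type} [MeasurableSpace α] {μ : Measure α} [IsProbabilityMeasure μ]
    {f : α → ℝ} (hf : Integrable f μ) (hef : Integrable (fun x => Real.exp (f x)) μ) :
    Real.exp (∫ x, f x ∂μ) ≤ ∫ x, Real.exp (f x) ∂μ :=
  convexOn_exp.map_integral_le Real.continuous_exp.continuousOn isClosed_univ
    (Eventually.of_forall fun _ => Set.mem_univ _) hf hef

/-- Induction on `s`: the step is `(1 - ∏ c_j)(1 - c_i) ≥ 0`. This is the covariance comparison for
the upper bound. -/
theorem sum_add_one_le_prod_add_card {ι : Type} (s : Finset ι) (c : ι → ℝ)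
    (hc : ∀ i, |c i| ≤ 1) : ∑ i ∈ s, c i + 1 ≤ ∏ i ∈ s, c i + s.card := by
  classical
  induction s using Finset.induction_on with
  | empty => simp
  | insert i s hi ih =>
    rw [Finset.sum_insert hi, Finset.prod_insert hi, Finset.card_insert_of_notMem hi]
    have h1 : ∏ j ∈ s, c j ≤ 1 := (le_abs_self _).trans (by
      rw [Finset.abs_prod]; exact Finset.prod_le_one (fun _ _ => abs_nonneg _) fun j _ => hc j)
    have h2 : c i ≤ 1 := (le_abs_self _).trans (hc i)
    push_cast
    nlinarith [mul_nonneg (sub_nonneg.2 h1) (sub_nonneg.2 h2)]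

/-- AM-GM applied to `|c j| ^ p`; evenness removes the absolute values. This is the covariance
comparison for the lower bound. -/
theorem prod_le_inv_mul_sum_pow {p : ℕ} (hp0 : 0 < p) (hp : Even p) (c : Fin p → ℝ) :
    ∏ j, c j ≤ (p : ℝ)⁻¹ * ∑ j, c j ^ p := by
  have hp' : (p : ℝ) ≠ 0 := by positivity
  have h := Real.geom_mean_le_arith_mean_weighted Finset.univ (fun _ : Fin p => (p : ℝ)⁻¹)
    (fun j => |c j| ^ p) (fun _ _ => by positivity) (by simp [hp'])
    (fun _ _ => by positivity)
  calc ∏ j, c j ≤ ∏ j, |c j| := by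
        rw [← Finset.abs_prod]; exact le_abs_self _
    _ = ∏ j, (|c j| ^ p) ^ (p : ℝ)⁻¹ :=
        Finset.prod_congr rfl fun j _ => (Real.pow_rpow_inv_natCast (abs_nonneg _) hp0.ne').symm
    _ ≤ _ := h
    _ = _ := by rw [Finset.mul_sum]; simp only [hp.pow_abs]

theorem sum_ciSup_le_ciSup_sum {J T : Type} [Fintype J] [Nonempty T] (f : J → T → ℝ)
    (hb : BddAbove (Set.range fun t : J → T => ∑ j, f j (t j))) :
    ∑ j, ⨆ t, f j t ≤ ⨆ t : J → T, ∑ j, f j (t j) := by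
  -- Suprema need not be attained, so near-maximisers are chosen separately for each `j`; the `+ 1`
  -- in the tolerance covers empty `J`.
  refine le_of_forall_pos_le_add fun ε hε => ?_
  have hδ : 0 < ε / (Fintype.card J + 1) := by positivity
  choose t ht using fun j => exists_lt_of_lt_ciSup (sub_lt_self (⨆ t, f j t) hδ)
  calc ∑ j, ⨆ t, f j t ≤ ∑ j, (f j (t j) + ε / (Fintype.card J + 1)) :=
        Finset.sum_le_sum fun j _ => by linarith [ht j]
    _ = ∑ j, f j (t j) + Fintype.card J * (ε / (Fintype.card J + 1)) := by
        rw [Finset.sum_add_distrib]; simp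
    _ ≤ _ := by
        refine add_le_add (le_ciSup hb t) ?_
        rw [← mul_div_assoc, div_le_iff₀ (by positivity)]
        nlinarith

/-! ### Comparison bounds for the spin models -/

section model

variable {p n : ℕ}

/-- Coefficients of the multipartite Hamiltonian in the disorder. -/
noncomputable def multiCoef (x : Fin p → EuclideanSpace ℝ (Fin n)) (i : Fin p → Fin n) : ℝ :=
  ∏ j, x j (i j)

theorem multiHamiltonian_eq (A : (Fin p → Fin n) → ℝ) (x : Fin p → EuclideanSpace ℝ (Fin n)) :
    multiHamiltonian A x = multiCoef x ⬝ᵥ A :=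
  Finset.sum_congr rfl fun _ _ => mul_comm _ _

theorem singleHamiltonian_eq (A : (Fin p → Fin n) → ℝ) (x : EuclideanSpace ℝ (Fin n)) :
    singleHamiltonian A x = multiCoef (fun _ => x) ⬝ᵥ A :=
  Finset.sum_congr rfl fun _ _ => mul_comm _ _

theorem sum_mul_eq_inner (x y : EuclideanSpace ℝ (Fin n)) : ∑ i, x i * y i = inner ℝ x y := by
  simp [PiLp.inner_apply, mul_comm]

theorem multiCoef_dotProduct (x y : Fin p → EuclideanSpace ℝ (Fin n)) :
    multiCoef x ⬝ᵥ multiCoef y = ∏ j, inner ℝ (x j) (y j) := by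
  simp only [← sum_mul_eq_inner, Finset.prod_univ_sum, Fintype.piFinset_univ, dotProduct,
    multiCoef, Finset.prod_mul_distrib]

theorem continuous_multiCoef :
    Continuous (multiCoef : (Fin p → EuclideanSpace ℝ (Fin n)) → (Fin p → Fin n) → ℝ) := by
  unfold multiCoef; fun_prop

variable {S : Set (EuclideanSpace ℝ (Fin n))}

theorem norm_eq_one_of_mem (hS : S ⊆ Metric.sphere 0 1) (x : S) :
    ‖(x : EuclideanSpace ℝ (Fin n))‖ = 1 := mem_sphere_zero_iff_norm.1 (hS x.2)

theorem inner_self_of_mem (hS : S ⊆ Metric.sphere 0 1) (x : S) :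
    inner ℝ (x : EuclideanSpace ℝ (Fin n)) x = 1 := by
  rw [real_inner_self_eq_norm_sq, norm_eq_one_of_mem hS, one_pow]

theorem abs_inner_le_one (hS : S ⊆ Metric.sphere 0 1) (x y : S) :
    |inner ℝ (x : EuclideanSpace ℝ (Fin n)) (y : EuclideanSpace ℝ (Fin n))| ≤ 1 := by
  have := abs_real_inner_le_norm (x : EuclideanSpace ℝ (Fin n)) (y : EuclideanSpace ℝ (Fin n))
  rwa [norm_eq_one_of_mem hS, norm_eq_one_of_mem hS, one_mul] at this

/-- The multipartite process on tuples of spins. -/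
noncomputable def multiProc (p : ℕ) (S : Set (EuclideanSpace ℝ (Fin n))) (x : Fin p → S) :
    (Fin p → Fin n) → ℝ := multiCoef fun j => (x j : EuclideanSpace ℝ (Fin n))

/-- The single-partite process. -/
noncomputable def singleProc (p : ℕ) (S : Set (EuclideanSpace ℝ (Fin n))) (x : S) :
    (Fin p → Fin n) → ℝ := multiCoef fun _ => (x : EuclideanSpace ℝ (Fin n))

/-- The linear process. -/
def linProc (S : Set (EuclideanSpace ℝ (Fin n))) (x : S) (i : Fin n) : ℝ :=
  (x : EuclideanSpace ℝ (Fin n)) i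

theorem multiProc_dotProduct (x y : Fin p → S) : multiProc p S x ⬝ᵥ multiProc p S y =
    ∏ j, inner ℝ (x j : EuclideanSpace ℝ (Fin n)) (y j) := multiCoef_dotProduct _ _

theorem singleProc_dotProduct (x y : S) : singleProc p S x ⬝ᵥ singleProc p S y =
    (inner ℝ (x : EuclideanSpace ℝ (Fin n)) y) ^ p := by
  simp [singleProc, multiCoef_dotProduct]

theorem linProc_dotProduct (x y : S) : linProc S x ⬝ᵥ linProc S y =
    inner ℝ (x : EuclideanSpace ℝ (Fin n)) y := sum_mul_eq_inner _ _

theorem continuous_multiProc : Continuous (multiProc p S) :=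
  continuous_multiCoef.comp (by fun_prop)

theorem multiProc_bound (hS : S ⊆ Metric.sphere 0 1) (x : Fin p → S) (i : Fin p → Fin n) :
    |multiProc p S x i| ≤ √1 :=
  abs_le_sqrt_of_dotProduct_self_eq
    (fun x => by simp [multiProc_dotProduct, norm_eq_one_of_mem hS]) x i

theorem singleProc_bound (hS : S ⊆ Metric.sphere 0 1) (x : S) (i : Fin p → Fin n) :
    |singleProc p S x i| ≤ √1 :=
  abs_le_sqrt_of_dotProduct_self_eq
    (fun x => by simp [singleProc_dotProduct, norm_eq_one_of_mem hS]) x i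

theorem linProc_bound (hS : S ⊆ Metric.sphere 0 1) (x : S) (i : Fin n) :
    |linProc S x i| ≤ √1 :=
  abs_le_sqrt_of_dotProduct_self_eq
    (fun x => by simp [linProc_dotProduct, norm_eq_one_of_mem hS]) x i

theorem multiEnergy_eq : multiEnergy p n (fun _ => S) =
    1 / √(n : ℝ) * ∫ A, gsup (multiProc p S) A ∂(stdNormalLaw (Fin p → Fin n)) := by
  unfold multiEnergy gsup
  congr 2; ext A
  rw [← sSup_range]
  congr 1; ext u
  simp only [Set.mem_image, Set.mem_range, multiHamiltonian_eq]
  constructor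
  · rintro ⟨x, hx, rfl⟩
    exact ⟨fun j => ⟨x j, hx j⟩, rfl⟩
  · rintro ⟨x, rfl⟩
    exact ⟨fun j => x j, fun j => (x j).2, rfl⟩

theorem singleEnergy_eq : singleEnergy p n S =
    1 / √(n : ℝ) * ∫ A, gsup (singleProc p S) A ∂(stdNormalLaw (Fin p → Fin n)) := by
  unfold singleEnergy gsup
  simp only [sSup_image', singleHamiltonian_eq]; rfl

theorem sSup_linear_eq (g : Fin n → ℝ) :
    sSup ((fun x : EuclideanSpace ℝ (Fin n) => ∑ i, g i * x i) '' S) = gsup (linProc S) g := by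
  rw [sSup_image']
  exact iSup_congr fun x => Finset.sum_congr rfl fun i _ => mul_comm _ _

/-- The comparison field consists of `p` independent single-partite copies, one for each spin
vector, so its supremum decouples. -/
theorem sqrt_mul_singleEnergy_le (hp0 : 0 < p) (hp : Even p) (hS : S ⊆ Metric.sphere 0 1)
    (hne : S.Nonempty) : √(p : ℝ) * singleEnergy p n S ≤ multiEnergy p n fun _ => S := by
  have := hne.to_subtype
  have hp' : (0 : ℝ) < p := by exact_mod_cast hp0
  set a : (Fin p → S) → Fin p × (Fin p → Fin n) → ℝ :=
    fun x q => (√(p : ℝ))⁻¹ * singleProc p S (x q.1) q.2 with ha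
  have hsq : (√(p : ℝ))⁻¹ * (√(p : ℝ))⁻¹ = (p : ℝ)⁻¹ := by
    rw [← mul_inv, Real.mul_self_sqrt hp'.le]
  have hdot : ∀ x y, a x ⬝ᵥ a y =
      (p : ℝ)⁻¹ * ∑ j, (inner ℝ (x j : EuclideanSpace ℝ (Fin n)) (y j)) ^ p := by
    intro x y
    simp only [← singleProc_dotProduct, dotProduct, Fintype.sum_prod_type, ha, Finset.mul_sum]
    refine Finset.sum_congr rfl fun j _ => Finset.sum_congr rfl fun i _ => ?_
    rw [← hsq]; ring
  have hself : ∀ x, a x ⬝ᵥ a x = 1 := fun x => by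
    simp [hdot, norm_eq_one_of_mem hS, hp'.ne']
  have hR := abs_le_sqrt_of_dotProduct_self_eq hself
  have hac : Continuous a := by
    refine continuous_pi fun q => continuous_const.mul ?_
    simp only [singleProc, multiCoef]; fun_prop
  have hle := integral_gsup_le hR (multiProc_bound hS) hac
    (fun x => by simp [hself, multiProc_dotProduct, norm_eq_one_of_mem hS])
    (fun x y => by rw [multiProc_dotProduct, hdot]; exact prod_le_inv_mul_sum_pow hp0 hp _)
  have hadot : ∀ x z, a x ⬝ᵥ z =
      ∑ j, (√(p : ℝ))⁻¹ * (singleProc p S (x j) ⬝ᵥ fun i => z (j, i)) := by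
    intro x z
    simp only [dotProduct, Fintype.sum_prod_type, ha, Finset.mul_sum, mul_assoc]
  have hblock : ∀ z, ∑ j : Fin p, (√(p : ℝ))⁻¹ * gsup (singleProc p S) (fun i => z (j, i)) ≤
      gsup a z := by
    intro z
    have h1 := sum_ciSup_le_ciSup_sum
      (fun (j : Fin p) (t : S) => (√(p : ℝ))⁻¹ * (singleProc p S t ⬝ᵥ fun i => z (j, i)))
      (by simpa only [hadot] using bddAbove_dotProduct hR z)
    simp only [gsup, hadot]
    refine le_trans (le_of_eq ?_) h1
    exact Finset.sum_congr rfl fun j _ => Real.mul_iSup_of_nonneg (by positivity) _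
  have mp : ∀ j : Fin p, MeasurePreserving
      (fun (z : Fin p × (Fin p → Fin n) → ℝ) i => z (j, i)) (stdNormalLaw _) (stdNormalLaw _) :=
    fun j => measurePreserving_comp_injective (Prod.mk_right_injective j)
  have hint := integrable_gsup (singleProc_bound (p := p) hS)
  have hint' : ∀ j : Fin p, Integrable (fun z : Fin p × (Fin p → Fin n) → ℝ =>
      (√(p : ℝ))⁻¹ * gsup (singleProc p S) (fun i => z (j, i))) (stdNormalLaw _) :=
    fun j => ((mp j).integrable_comp_of_integrable hint).const_mul _
  have hsum : ∫ z, ∑ j : Fin p, (√(p : ℝ))⁻¹ * gsup (singleProc p S) (fun i => z (j, i))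
      ∂(stdNormalLaw (Fin p × (Fin p → Fin n))) =
      √(p : ℝ) * ∫ A, gsup (singleProc p S) A ∂(stdNormalLaw (Fin p → Fin n)) := by
    rw [integral_finsetSum _ fun j _ => hint' j]
    simp only [integral_const_mul]
    rw [Finset.sum_congr rfl fun j _ => congrArg _
      ((mp j).integral_comp_of_aestronglyMeasurable hint.aestronglyMeasurable)]
    rw [Finset.sum_const, Finset.card_univ, Fintype.card_fin, nsmul_eq_mul, ← mul_assoc]
    congr 1
    -- The `p` copies with weight `1 / √p` contribute `p / √p = √p`.
    rw [← div_eq_mul_inv, Real.div_sqrt]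
  rw [multiEnergy_eq, singleEnergy_eq, ← mul_assoc, mul_comm (√(p : ℝ)), mul_assoc, ← hsum]
  refine mul_le_mul_of_nonneg_left (le_trans ?_ hle) (by positivity)
  exact integral_mono (integrable_finsetSum _ fun j _ => hint' j) (integrable_gsup hR) hblock

theorem integral_multi_add_le (hp0 : 0 < p) (hS : S ⊆ Metric.sphere 0 1) (hne : S.Nonempty)
    {c : ℝ} (hc : 0 < c) :
    c * (∫ A, gsup (multiProc p S) A ∂(stdNormalLaw (Fin p → Fin n))) + c ^ 2 / 2 * ((p : ℝ) - 1) ≤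
      p * Real.log (∫ g, Real.exp (c * gsup (linProc S) g) ∂(stdNormalLaw (Fin n))) := by
  have := hne.to_subtype
  have hp1 : (0 : ℝ) ≤ (p : ℝ) - 1 := by
    have : (1 : ℝ) ≤ p := by exact_mod_cast hp0
    linarith
  -- The extra coordinate adds the constant `p - 1` to every covariance, raising the variance from
  -- `1` to `p` to match `b`.
  set a : (Fin p → S) → (Fin p → Fin n) ⊕ Unit → ℝ :=
    fun x => Sum.elim (multiProc p S x) (fun _ => √((p : ℝ) - 1)) with ha
  set b : (Fin p → S) → Fin p × Fin n → ℝ := fun x q => linProc S (x q.1) q.2 with hb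
  have hadot : ∀ x y, a x ⬝ᵥ a y =
      ∏ j, inner ℝ (x j : EuclideanSpace ℝ (Fin n)) (y j) + ((p : ℝ) - 1) := by
    intro x y
    rw [← multiProc_dotProduct]
    simp [ha, dotProduct, Real.mul_self_sqrt hp1]
  have hbdot : ∀ x y, b x ⬝ᵥ b y = ∑ j, inner ℝ (x j : EuclideanSpace ℝ (Fin n)) (y j) := by
    intro x y
    simp only [← linProc_dotProduct, dotProduct, Fintype.sum_prod_type, hb]
  have hbself : ∀ x, b x ⬝ᵥ b x = p := fun x => by simp [hbdot, norm_eq_one_of_mem hS]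
  have haself : ∀ x, a x ⬝ᵥ a x = p := fun x => by simp [hadot, norm_eq_one_of_mem hS]
  have hRa := abs_le_sqrt_of_dotProduct_self_eq haself
  have hRb := abs_le_sqrt_of_dotProduct_self_eq hbself
  have hac : Continuous a := by
    refine continuous_pi fun q => ?_
    rcases q with q | q
    · exact (continuous_apply q).comp continuous_multiProc
    · exact continuous_const
  have hle := integral_exp_gsup_le hRa hRb hac (fun x => by rw [haself, hbself])
    (fun x y => by
      have := sum_add_one_le_prod_add_card Finset.univ
        (fun j => inner ℝ (x j : EuclideanSpace ℝ (Fin n)) (y j))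
        (fun j => abs_inner_le_one hS _ _)
      rw [Finset.card_univ, Fintype.card_fin] at this
      rw [hadot, hbdot]; linarith) hc
  have hmb := multiProc_bound (p := p) hS
  have hlb := linProc_bound hS
  have hga : ∀ z, gsup a z = gsup (multiProc p S) (z ∘ Sum.inl) +
      √((p : ℝ) - 1) * (z ∘ Sum.inr) () := by
    intro z
    simp only [gsup]
    rw [ciSup_add (bddAbove_dotProduct hmb _)]
    refine iSup_congr fun x => ?_
    simp [ha, dotProduct]
  have hlhs : ∫ z, Real.exp (c * gsup a z) ∂(stdNormalLaw ((Fin p → Fin n) ⊕ Unit)) =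
      (∫ A, Real.exp (c * gsup (multiProc p S) A) ∂(stdNormalLaw (Fin p → Fin n))) *
        Real.exp (c ^ 2 / 2 * ((p : ℝ) - 1)) := by
    simp only [hga, mul_add, Real.exp_add]
    rw [integral_mul_sum (fun A => Real.exp (c * gsup (multiProc p S) A))
      (fun y : Unit → ℝ => Real.exp (c * (√((p : ℝ) - 1) * y ())))]
    congr 1
    simp only [← mul_assoc]
    rw [integral_exp_mul_eval, mul_pow, Real.sq_sqrt hp1]
    congr 1; ring
  have hgb : ∀ z, gsup b z ≤ ∑ j : Fin p, gsup (linProc S) (fun i => z (j, i)) := by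
    intro z
    refine (gsup_le_iff hRb z _).2 fun x => ?_
    simp only [dotProduct, Fintype.sum_prod_type, hb]
    exact Finset.sum_le_sum fun j _ => le_ciSup (bddAbove_dotProduct hlb _) (x j)
  have hmeas : Measurable fun g => Real.exp (c * gsup (linProc S) g) :=
    Real.measurable_exp.comp ((measurable_gsup hlb).const_mul c)
  have hrhs : ∫ z, Real.exp (c * gsup b z) ∂(stdNormalLaw (Fin p × Fin n)) ≤
      (∫ g, Real.exp (c * gsup (linProc S) g) ∂(stdNormalLaw (Fin n))) ^ p := by
    have e := integral_prod_blocks (ι := Fin p) hmeas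
    rw [Fintype.card_fin] at e
    rw [← e]
    refine integral_mono (integrable_exp_gsup hRb c) ?_ fun z => ?_
    · have hi : Integrable (fun ζ : Fin p → Fin n → ℝ =>
          ∏ j, Real.exp (c * gsup (linProc S) (ζ j))) (Measure.pi fun _ => stdNormalLaw (Fin n)) :=
        Integrable.fintype_prod fun _ => integrable_exp_gsup hlb c
      have hm : Measurable fun z : Fin p × Fin n → ℝ =>
          ∏ j : Fin p, Real.exp (c * gsup (linProc S) (fun i => z (j, i))) :=
        Finset.measurable_fun_prod _ fun j _ => hmeas.comp (by fun_prop)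
      exact (measurePreserving_uncurry.integrable_comp hm.aestronglyMeasurable).1 hi
    · rw [← Real.exp_sum, ← Finset.mul_sum]
      exact Real.exp_le_exp.2 (mul_le_mul_of_nonneg_left (hgb z) hc.le)
  -- Jensen turns the exponential moment of the multipartite supremum into its mean.
  have hjen := exp_integral_le ((integrable_gsup hmb).const_mul c) (integrable_exp_gsup hmb c)
  rw [integral_const_mul] at hjen
  have hfin : Real.exp (c * (∫ A, gsup (multiProc p S) A ∂(stdNormalLaw (Fin p → Fin n))) +
      c ^ 2 / 2 * ((p : ℝ) - 1)) ≤
      (∫ g, Real.exp (c * gsup (linProc S) g) ∂(stdNormalLaw (Fin n))) ^ p := by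
    rw [Real.exp_add]
    refine (mul_le_mul_of_nonneg_right hjen (Real.exp_pos _).le).trans ?_
    rw [← hlhs]
    exact hle.trans hrhs
  have := Real.log_le_log (Real.exp_pos _) hfin
  rwa [Real.log_exp, Real.log_pow] at this

theorem multiEnergy_le (hp0 : 0 < p) (hn : 0 < n) (hS : S ⊆ Metric.sphere 0 1)
    (hne : S.Nonempty) {c : ℝ} (hc : 0 < c) :
    (multiEnergy p n fun _ => S) ≤ √(p : ℝ) * liftedBound p n S (c * √(n : ℝ)) := by
  have hp' : 0 < √(p : ℝ) := Real.sqrt_pos.2 (by exact_mod_cast hp0)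
  have hn' : 0 < √(n : ℝ) := Real.sqrt_pos.2 (by exact_mod_cast hn)
  have hpp : √(p : ℝ) * √(p : ℝ) = p := Real.mul_self_sqrt (by positivity)
  -- The extra factor `√p` matches the exponent in `liftedBound`; after division the quadratic term
  -- is exactly `√p` times the one there.
  have h := integral_multi_add_le hp0 hS hne (c := c * √(n : ℝ) * √(p : ℝ)) (by positivity)
  rw [multiEnergy_eq, liftedBound, mul_left_comm]
  refine mul_le_mul_of_nonneg_left ?_ (by positivity)
  simp only [sSup_linear_eq]
  set M := ∫ A, gsup (multiProc p S) A ∂(stdNormalLaw (Fin p → Fin n))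
  set l := Real.log (∫ g, Real.exp (c * √(n : ℝ) * √(p : ℝ) * gsup (linProc S) g)
    ∂(stdNormalLaw (Fin n)))
  set r := √(p : ℝ)
  set s := c * √(n : ℝ)
  have hs : 0 < s := by positivity
  rw [← hpp] at h ⊢
  have hsr : 0 < s * r := by positivity
  have e : s * r * (r * (-(s / 2) * (r * r - 1) + 1 / s * l)) =
      r * r * l - (s * r) ^ 2 / 2 * (r * r - 1) := by field_simp; ring
  refine le_of_mul_le_mul_left ?_ hsr
  rw [e]; linarith

/-! ### Uniform bound on the lifted energies -/

theorem integrable_exp_sq_div_four :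
    Integrable (fun x : ℝ => Real.exp (x ^ 2 / 4)) (gaussianReal 0 1) := by
  rw [gaussianReal_of_var_ne_zero _ one_ne_zero, gaussianPDF_def,
    integrable_withDensity_iff_integrable_smul' (by fun_prop) (by simp)]
  refine ((integrable_exp_neg_mul_sq (b := 1 / 4) (by norm_num)).const_mul
    (√(2 * Real.pi))⁻¹).congr (Eventually.of_forall fun x => ?_)
  simp only [gaussianPDFReal, NNReal.coe_one, mul_one, sub_zero, smul_eq_mul]
  rw [ENNReal.toReal_ofReal (by positivity), mul_assoc, ← Real.exp_add]
  congr 2; ring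

theorem exists_liftedBound_le (p : ℕ) {c : ℝ} (hc : 0 < c) : ∃ K : ℝ, ∀ n : ℕ, 0 < n →
    ∀ S : Set (EuclideanSpace ℝ (Fin n)), S ⊆ Metric.sphere 0 1 → S.Nonempty →
    liftedBound p n S (c * √(n : ℝ)) ≤ K := by
  set J := ∫ x, Real.exp (x ^ 2 / 4) ∂(gaussianReal 0 1) with hJ
  have hJpos : 0 < J := integral_exp_pos integrable_exp_sq_div_four
  refine ⟨-(c / 2) * ((p : ℝ) - 1) + 1 / c * (c ^ 2 * p + Real.log J), fun n hn S hS hne => ?_⟩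
  have := hne.to_subtype
  have hn0 : (0 : ℝ) < n := by exact_mod_cast hn
  have hn' : 0 < √(n : ℝ) := Real.sqrt_pos.2 hn0
  have hnn : √(n : ℝ) ^ 2 = n := Real.sq_sqrt hn0.le
  have hpp : √(p : ℝ) ^ 2 = p := Real.sq_sqrt (by positivity)
  have hlb := linProc_bound hS
  simp only [liftedBound, sSup_linear_eq]
  set s := c * √(n : ℝ) * √(p : ℝ) with hs
  have hs0 : 0 ≤ s := by positivity
  -- Coordinatewise `s x g ≤ s² x² + g² / 4`, summed over a unit vector. The weight `1/4` is below
  -- the Gaussian threshold `1/2`, so `J` is finite.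
  have hpt : ∀ g, s * gsup (linProc S) g ≤ s ^ 2 + ∑ i, g i ^ 2 / 4 := by
    intro g
    rw [gsup, Real.mul_iSup_of_nonneg hs0]
    refine ciSup_le fun x => ?_
    have hx : ∑ i, s ^ 2 * (linProc S x i * linProc S x i) = s ^ 2 := by
      rw [← Finset.mul_sum, show ∑ i, linProc S x i * linProc S x i = 1 from
        (linProc_dotProduct x x).trans (inner_self_of_mem hS x), mul_one]
    conv_rhs => rw [← hx]
    rw [← Finset.sum_add_distrib, dotProduct, Finset.mul_sum]
    refine Finset.sum_le_sum fun i _ => ?_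
    nlinarith [sq_nonneg (s * linProc S x i - g i / 2)]
  have hi : Integrable (fun g : Fin n → ℝ => ∏ i, Real.exp (g i ^ 2 / 4))
      (stdNormalLaw (Fin n)) := Integrable.fintype_prod fun _ => integrable_exp_sq_div_four
  have hint : ∫ g, Real.exp (s * gsup (linProc S) g) ∂(stdNormalLaw (Fin n)) ≤
      Real.exp (s ^ 2) * J ^ n := by
    have e : ∫ g : Fin n → ℝ, ∏ i, Real.exp (g i ^ 2 / 4) ∂(stdNormalLaw (Fin n)) = J ^ n := by
      rw [stdNormalLaw, integral_fintype_prod_eq_pow (fun x : ℝ => Real.exp (x ^ 2 / 4)),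
        Fintype.card_fin]
    rw [← e, ← integral_const_mul]
    refine integral_mono (integrable_exp_gsup hlb s) (hi.const_mul _) fun g => ?_
    simp only [← Real.exp_sum, ← Real.exp_add]
    exact Real.exp_le_exp.2 (hpt g)
  have hlog := Real.log_le_log (integral_exp_pos (integrable_exp_gsup hlb s)) hint
  rw [Real.log_mul (Real.exp_pos _).ne' (pow_pos hJpos n).ne', Real.log_exp, Real.log_pow] at hlog
  -- Both terms of the logarithm are linear in `n`, which the normalisation cancels.
  have hs2 : s ^ 2 = n * (c ^ 2 * p) := by rw [hs, mul_pow, mul_pow, hnn, hpp]; ring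
  rw [hs2, ← mul_add] at hlog
  calc _ ≤ 1 / √(n : ℝ) * (-(c * √(n : ℝ) / 2) * ((p : ℝ) - 1) +
        1 / (c * √(n : ℝ)) * (√(n : ℝ) ^ 2 * (c ^ 2 * p + Real.log J))) := by
        rw [hnn]; gcongr
    _ = _ := by field_simp

end model

end PSpin

/-! ### The limit -/

theorem mainTheorem7 (p : ℕ) (hp : 2 < p) (hp_even : Even p)
    (Sbar : Fin p → (n : ℕ) → Set (EuclideanSpace ℝ (Fin n)))
    (S : (n : ℕ) → Set (EuclideanSpace ℝ (Fin n)))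
    (hS_sphere : ∀ n : ℕ, S n ⊆ Metric.sphere 0 1)
    (hS_nonempty : ∀ n : ℕ, 1 ≤ n → (S n).Nonempty)
    (hSbar : ∀ j : Fin p, Sbar j = S)
    (G : ℝ) (hG : PSpin.IsSingleGSE p S G) (hlevel : PSpin.IsSecondPartialLevel p S G) :
    PSpin.IsMultiGSE p Sbar (√(p : ℝ) * G) := by
  have hp0 : 0 < p := by omega
  have hp' : 0 < √(p : ℝ) := Real.sqrt_pos.2 (by exact_mod_cast hp0)
  unfold PSpin.IsMultiGSE
  simp only [hSbar]
  refine tendsto_order.2 ⟨fun r hr => ?_, fun r hr => ?_⟩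
  -- The restriction `n ≥ 1` is needed: the unit sphere of `ℝ⁰` is empty.
  · filter_upwards [(hG.const_mul √(p : ℝ)).eventually_const_lt hr, eventually_ge_atTop 1]
      with n hn hn1
    exact hn.trans_le
      (PSpin.sqrt_mul_singleEnergy_le hp0 hp_even (hS_sphere n) (hS_nonempty n hn1))
  · have hr' : G < r / √(p : ℝ) := by rwa [lt_div_iff₀ hp', mul_comm]
    -- The infimum need not be attained; a `c` whose limiting bound lies below `r / √p` suffices.
    obtain ⟨_, ⟨c, hc, rfl⟩, hlt⟩ := (isGLB_lt_iff hlevel).1 hr'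
    obtain ⟨K, hK⟩ := PSpin.exists_liftedBound_le p (Set.mem_Ioi.1 hc)
    -- A real `limsup` controls the sequence only when the latter is bounded above.
    have hbdd : IsBoundedUnder (· ≤ ·) atTop
        fun n : ℕ => PSpin.liftedBound p n (S n) (c * √(n : ℝ)) :=
      ⟨K, eventually_map.2 (by
        filter_upwards [eventually_ge_atTop 1] with n hn
        exact hK n hn (S n) (hS_sphere n) (hS_nonempty n hn))⟩
    filter_upwards [eventually_lt_of_limsup_lt hlt hbdd, eventually_ge_atTop 1] with n hn hn1
    refine (PSpin.multiEnergy_le hp0 hn1 (hS_sphere n) (hS_nonempty n hn1) hc).trans_lt ?_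
    rwa [mul_comm, ← lt_div_iff₀ hp']
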